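/- Let $d\ge 1$, let $E$ be a finite set with its discrete $\sigma$-algebra, and let $\Omega=E^{\mathbb Z^d}$ carry the product $\sigma$-algebra. For a set $\Delta$ of sites let $\mathcal F_\Delta$ be the $\sigma$-algebra generated by the spins in $\Delta$, let $\rho$ be the product of the uniform distributions on $E$, and let $\Lambda_n=[-n,n]^d\cap\mathbb Z^d$. A site $x$ acts by $(\tau_x\omega)_i=\omega_{i-x}$; a measure is translation-invariant if it is preserved by all $\tau_x$. For a measure $\mu$, $\mu(\sigma_\Lambda)$ is the probability of the cylinder $\{\omega:\omega_\Lambda=\sigma_\Lambda\}$. Fix a spin $+\in E$ and denote also by $+$ the configuration that is constantly equal to it. A specification $\gamma=(\gamma_\Lambda)$, indexed by the finite $\Lambda\subset\mathbb Z^d$, is a family of probability kernels on $\Omega$ such that $\gamma_\Lambda(A|\cdot)$ is $\mathcal F_{\Lambda^c}$-measurable for every event $A$, $\gamma_\Lambda(B|\cdot)=\mathbf 1_B$ for $B\in\mathcal F_{\Lambda^c}$, and $\gamma_\Lambda\gamma_{\Lambda'}=\gamma_\Lambda$ for $\Lambda'\subset\Lambda$. It is translation-invariant if $\gamma_{\Lambda+x}(\tau_xA|\tau_x\omega)=\gamma_\Lambda(A|\omega)$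 always, and uniformly non-null if for each $\Lambda$ there are $0<\alpha_\Lambda\le\beta_\Lambda<\infty$ with $\alpha_\Lambda\rho(A)\le\gamma_\Lambda(A|\omega)\le\beta_\Lambda\rho(A)$ for all $\omega\in\Omega$ and $A\in\mathcal F_\Lambda$. Let $\mathcal G_{\rm inv}(\gamma)$ be the set of translation-invariant probability measures $\mu$ with $\mu\gamma_\Lambda=\mu$ for all finite $\Lambda$. Write $\gamma_\Lambda(\sigma|\omega)$ for the $\gamma_\Lambda(\cdot|\omega)$-probability of the cylinder of $\sigma_\Lambda$, $\gamma_\Lambda f(\omega)=\int f\,d\gamma_\Lambda(\cdot|\omega)$, and $\gamma_0=\gamma_{\{0\}}$. Let $$\Omega_\gamma=\Big\{\omega:\ \lim_{n\to\infty}\sup_{\sigma\in\Omega}\big|\gamma_\Lambda f(\omega_{\Lambda_n}\sigma_{\Lambda_n^c})-\gamma_\Lambda f(\omega)\big|=0\ \text{ for all finite }\Lambda\text{ and all local } f\Big\},$$ where a local function is one that depends on finitely many spins. For $\sigma\in\Omega$ let $\sigma^+_i=\sigma_i$ if $i\ge 0$ in the lexicographic order of $\mathbb Z^d$ and $\sigma^+_i=+$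 otherwise, and let $\Omega_\gamma^{<0}=\{\sigma:\sigma^+\in\Omega_\gamma\}$. Finally let $$h(\mu)=-\lim_{n}\frac1{|\Lambda_n|}\sum_{\sigma_{\Lambda_n}}\mu(\sigma_{\Lambda_n})\log\mu(\sigma_{\Lambda_n}),\qquad h(\mu|\nu)=\lim_n\frac1{|\Lambda_n|}\mathcal H_{\Lambda_n}(\mu|\nu),\qquad e_\nu^+=-\lim_n\frac1{|\Lambda_n|}\log\nu(+_{\Lambda_n}),$$ where $\mathcal H_\Lambda(\mu|\nu)\in[0,\infty]$ is the relative entropy of the marginal of $\mu$ on $E^\Lambda$ with respect to that of $\nu$. **Theorem.** Let $\gamma$ be a translation-invariant, uniformly non-null specification and let $\nu\in\mathcal G_{\rm inv}(\gamma)$. Let $\mu$ be a translation-invariant probability measure with $\mu(\Omega_\gamma^{<0})=1$, and suppose that $e_\nu^+$ exists as a real number. Then: 1. The limits $h(\mu)$ and $h(\mu|\nu)$ exist and are finite, the function $\sigma\mapsto\log\frac{\gamma_0(\sigma^+|\sigma^+)}{\gamma_0(+|\sigma^+)}$ is $\mu$-integrable, and $$h(\mu|\nu)=-h(\mu)+e_\nu^+-\int_\Omega\log\frac{\gamma_0(\sigma^+|\sigma^+)}{\gamma_0(+|\sigma^+)}\,\mu(d\sigma).$$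 2. If moreover $\mu\in\mathcal G_{\rm inv}(\gamma)$, then $$h(\mu|\nu)=\lim_{n\to\infty}\frac1{|\Lambda_n|}\log\frac{\mu(+_{\Lambda_n})}{\nu(+_{\Lambda_n})},$$ and in particular this limit exists. -/

import Mathlib

open MeasureTheory ProbabilityTheory Filter Topology
open scoped ENNReal

noncomputable section

namespace DLR

/-- Sites of the lattice `ℤ^d`. -/
abbrev Site (d : ℕ) : Type := Fin d → ℤ

/-- Configurations `Ω = E^{ℤ^d}`, with the product σ-algebra. -/
abbrev Config (d : ℕ) (E : Type*) : Type _ := Site d → E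

/-- The cube `Λ_n = [-n, n]^d`. -/
def cube (d n : ℕ) : Finset (Site d) :=
  Finset.Icc (fun _ => -(n : ℤ)) (fun _ => (n : ℤ))

section Configurations

variable {d : ℕ} {E : Type*}

/-- The translation `(τ_x ω)_i = ω_{i - x}`. -/
def shift (x : Site d) (ω : Config d E) : Config d E := fun i => ω (i - x)

/-- The concatenation `ω_Λ σ_{Λᶜ}`. -/
def glue (Λ : Finset (Site d)) (ω σ : Config d E) : Config d E :=
  fun i => if i ∈ Λ then ω i else σ i

/-- The cylinder `{ω : ω_Λ = σ_Λ}`. -/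
def cyl (Λ : Finset (Site d)) (σ : Config d E) : Set (Config d E) :=
  {ω | ∀ i ∈ Λ, ω i = σ i}

/-- The configuration which equals `p` everywhere (the reference configuration). -/
def const (d : ℕ) (p : E) : Config d E := fun _ => p

open Classical in
/-- The configuration `σ^+`: it is `σ_i` at the sites `i ≥ 0` in the lexicographic order of `ℤ^d`,
and the reference spin `p` at all other sites. -/
def plusPast (p : E) (σ : Config d E) : Config d E :=
  fun i => if toLex (0 : Site d) ≤ toLex i then σ i else p

/-- A function is local when it depends on finitely many spins only. (The spin space is finite,
so such a function is measurable and takes finitely many values.) -/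
def IsLocal (f : Config d E → ℝ) : Prop :=
  ∃ Λ : Finset (Site d), DependsOn f (Λ : Set (Site d))

end Configurations

/-- A specification: a family of probability kernels indexed by the finite sets of sites, each
measurable with respect to the spins outside `Λ`, proper, and consistent. -/
structure Specification (d : ℕ) (E : Type*) [MeasurableSpace E] where
  /-- the kernel `γ_Λ(· | ω)` -/
  ker : Finset (Site d) → Kernel (Config d E) (Config d E)
  isMarkov : ∀ Λ, IsMarkovKernel (ker Λ)
  measurable_outside : ∀ (Λ : Finset (Site d)) (A : Set (Config d E)), MeasurableSet A →
    Measurable[cylinderEvents ((Λ : Set (Site d))ᶜ)] (fun ω => ker Λ ω A)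
  proper : ∀ (Λ : Finset (Site d)) (B : Set (Config d E)),
    MeasurableSet[cylinderEvents ((Λ : Set (Site d))ᶜ)] B →
      ∀ ω, ker Λ ω B = B.indicator (fun _ => (1 : ℝ≥0∞)) ω
  consistent : ∀ (Λ' Λ : Finset (Site d)), Λ' ⊆ Λ →
    ∀ (A : Set (Config d E)), MeasurableSet A →
      ∀ ω, ∫⁻ ω', ker Λ' ω' A ∂(ker Λ ω) = ker Λ ω A

section Measures

variable {d : ℕ} {E : Type*} [MeasurableSpace E]

/-- The a priori measure: the product over all sites of the uniform distribution on `E`. -/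
def apriori (d : ℕ) (E : Type*) [MeasurableSpace E] [Finite E] [Nonempty E] :
    Measure (Config d E) :=
  Measure.infinitePi (fun _ : Site d => uniformOn (Set.univ : Set E))

/-- Translation-invariant measures. -/
def IsTranslationInvariant (μ : Measure (Config d E)) : Prop :=
  ∀ x : Site d, μ.map (shift x) = μ

/-- The entropy per site `h_n(μ)` in the cube `Λ_n`. -/
def entropyPerSite [Fintype E] (μ : Measure (Config d E)) (n : ℕ) : ℝ :=
  (∑ η : (cube d n → E), Real.negMulLog (μ.real ((cube d n).restrict ⁻¹' {η}))) /
    ((cube d n).card : ℝ)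

/-- `h(μ)` exists and equals `h`. -/
def HasEntropy [Fintype E] (μ : Measure (Config d E)) (h : ℝ) : Prop :=
  Tendsto (entropyPerSite μ) atTop (𝓝 h)

/-- The relative entropy `H_Λ(μ | ν) ∈ [0, ∞]` of the marginal of `μ` on `E^Λ` with respect to
that of `ν`. -/
def relEntropy (Λ : Finset (Site d)) (μ ν : Measure (Config d E)) : ℝ≥0∞ :=
  InformationTheory.klDiv (μ.map Λ.restrict) (ν.map Λ.restrict)

/-- The relative entropy density `h(μ | ν) = lim_n |Λ_n|⁻¹ H_{Λ_n}(μ | ν)` exists and equals the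
real number `h`. The limit is taken in the extended reals. -/
def HasRelEntropyDensity (μ ν : Measure (Config d E)) (h : ℝ) : Prop :=
  Tendsto (fun n : ℕ => ((relEntropy (cube d n) μ ν / ((cube d n).card : ℝ≥0∞) : ℝ≥0∞) : EReal))
    atTop (𝓝 (h : EReal))

/-- The `ν`-specific energy `e_ν^+ = -lim_n |Λ_n|⁻¹ log ν(+_{Λ_n})` of the constant configuration
with spin `p` exists and equals `e`. -/
def HasSpecificEnergy (ν : Measure (Config d E)) (p : E) (e : ℝ) : Prop :=
  Tendsto (fun n : ℕ => -(Real.log (ν.real (cyl (cube d n) (const d p))) / ((cube d n).card : ℝ)))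
    atTop (𝓝 e)

namespace Specification

variable (γ : Specification d E)

/-- `γ_Λ(σ | ω)`: the probability of `σ_Λ` in `Λ` under the boundary condition `ω`. -/
def prob (Λ : Finset (Site d)) (σ ω : Config d E) : ℝ := (γ.ker Λ ω).real (cyl Λ σ)

/-- `γ_Λ f (ω) = ∫ f dγ_Λ(· | ω)`. -/
def act (Λ : Finset (Site d)) (f : Config d E → ℝ) (ω : Config d E) : ℝ :=
  ∫ σ, f σ ∂(γ.ker Λ ω)

/-- Translation-invariance: `γ_{Λ + x}(τ_x A | τ_x ω) = γ_Λ(A | ω)`. -/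
def IsTranslationInvariant : Prop :=
  ∀ (x : Site d) (Λ : Finset (Site d)) (ω : Config d E),
    (γ.ker Λ ω).map (shift x) = γ.ker (Λ.map (addRightEmbedding x)) (shift x ω)

/-- Uniform non-nullness: inside `Λ`, the measures `γ_Λ(· | ω)` are comparable to the a priori
measure, uniformly in the boundary condition `ω`. -/
def IsUniformlyNonNull [Finite E] [Nonempty E] : Prop :=
  ∀ Λ : Finset (Site d), ∃ α β : ℝ, 0 < α ∧ α ≤ β ∧
    ∀ (ω : Config d E) (A : Set (Config d E)),
      MeasurableSet[cylinderEvents (Λ : Set (Site d))] A →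
        ENNReal.ofReal α * apriori d E A ≤ γ.ker Λ ω A ∧
          γ.ker Λ ω A ≤ ENNReal.ofReal β * apriori d E A

/-- `μ ∈ G(γ)`: `μ` is a probability measure with `μ γ_Λ = μ` for every finite `Λ`. -/
def IsDLR (μ : Measure (Config d E)) : Prop :=
  IsProbabilityMeasure μ ∧ ∀ Λ : Finset (Site d), μ.bind (γ.ker Λ) = μ

/-- `μ ∈ G_inv(γ)`. -/
def IsInvariantDLR (μ : Measure (Config d E)) : Prop :=
  γ.IsDLR μ ∧ DLR.IsTranslationInvariant μ

/-- The set `Ω_γ` of good configurations, i.e. of the points of continuity of `γ`. -/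
def goodSet : Set (Config d E) :=
  {ω | ∀ (Λ : Finset (Site d)) (f : Config d E → ℝ), IsLocal f →
    Tendsto (fun n : ℕ => ⨆ σ : Config d E, |γ.act Λ f (glue (cube d n) ω σ) - γ.act Λ f ω|)
      atTop (𝓝 0)}

/-- The set `Ω_γ^{<0} = {σ : σ^+ ∈ Ω_γ}`. -/
def goodPastSet (p : E) : Set (Config d E) := {σ | plusPast p σ ∈ γ.goodSet}

/-- `D(σ^+) = log (γ_0(σ^+ | σ^+) / γ_0(+ | σ^+))`. -/
def logRatio (p : E) (σ : Config d E) : ℝ :=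
  Real.log (γ.prob {0} (plusPast p σ) (plusPast p σ) / γ.prob {0} (const d p) (plusPast p σ))

end Specification

end Measures

end DLR

end

/-! Everything rests on one limit (`tendsto_integral_log_cyl`): for every DLR measure `ν`, the
average over `Λ_n` of `∫ log ν(σ_{Λ_n}) dμ - log ν(+_{Λ_n})` tends to `∫ logRatio dμ`. Turn the
spins of `σ` into `+` one site at a time in lexicographic order (`sum_increments`). At the step at
`i`, two cylinders are compared that differ only at `i`, with `+` before `i` and `σ` after it. By
the DLR equations the logarithm of their `ν`-ratio lies between the extreme values of the
single-site log-ratios of `γ` over the compatible configurations (`abs_log_ratio_sub_le`). If `i` is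
at depth `m` in the cube, translation by `-i` makes these agree on `Λ_m` with `plusPast` of the
translate of `σ`, so the error is an oscillation of `γ_0` there. Its `μ`-integral vanishes as `m →
∞` because `μ` charges only good pasts. Non-nullness bounds the sites near the boundary, which are a
negligible fraction. The relative entropy in `Λ_n` is minus the entropy minus `∫ log ν(σ_{Λ_n}) dμ`,
so the first claim follows once `h(μ)` exists, which is the same averaging argument with strong
subadditivity. For the second, apply the limit with `μ` in the place of `ν`: then `∫ log μ(σ_{Λ_n})
dμ` is minus the entropy, and `log μ(+_{Λ_n})` is left. -/

namespace DLR

/-! ### Local functions and cylinder events -/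

section LocalFunctions

variable {d : ℕ} {E : Type*}

theorem exists_bound_of_dependsOn [Finite E] {Λ : Finset (Site d)} {f : Config d E → ℝ}
    (hf : DependsOn f (Λ : Set (Site d))) : ∃ C, ∀ ω, |f ω| ≤ C := by
  obtain ⟨g, rfl⟩ := dependsOn_iff_exists_comp.1 hf
  obtain ⟨C, hC⟩ := (Set.finite_range fun x => |g x|).bddAbove
  exact ⟨C, fun ω => hC ⟨_, rfl⟩⟩

theorem dependsOn_mem_cyl (Λ : Finset (Site d)) (σ : Config d E) :
    DependsOn (fun ω => ω ∈ cyl Λ σ) (Λ : Set (Site d)) := by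
  intro x y h
  simp only [cyl, Set.mem_ofPred_eq, eq_iff_iff]
  exact forall₂_congr fun i hi => by rw [h i hi]

theorem cyl_congr {Λ : Finset (Site d)} {σ τ : Config d E} (h : ∀ i ∈ Λ, σ i = τ i) :
    cyl Λ σ = cyl Λ τ := by
  ext ω
  exact forall₂_congr fun i hi => by rw [h i hi]

theorem dependsOn_comp_cyl {β : Type*} (Λ : Finset (Site d)) (F : Set (Config d E) → β) :
    DependsOn (fun ω => F (cyl Λ ω)) (Λ : Set (Site d)) :=
  fun _ _ h => by
    simp only [cyl_congr h]

variable [MeasurableSpace E]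

/-- A function that is measurable with respect to the spins in `Δ` depends on these spins only. -/
theorem dependsOn_of_measurable_cylinderEvents {β : Type*} [MeasurableSpace β]
    [MeasurableSingletonClass β] {Δ : Set (Site d)} {f : Config d E → β}
    (hf : Measurable[cylinderEvents Δ] f) : DependsOn f Δ := by
  intro x y hxy
  -- For the trivial σ-algebra on `Bool`, measurability of `g` says that `x` and `y` agree on `Δ`; a
  -- set measurable for it is empty or everything, so `f` cannot separate the two points.
  let g : Bool → Config d E := fun b => if b then x else y
  have hg : @Measurable _ _ ⊥ (cylinderEvents Δ) g := by
    rw [@measurable_cylinderEvents_iff _ _ _ ⊥]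
    intro i hi
    have : (fun b => g b i) = fun _ => y i := by
      funext b
      cases b <;> simp [g, hxy i hi]
    rw [this]
    exact @measurable_const _ _ _ ⊥ _
  have h := (hf.comp hg) (measurableSet_singleton (f x))
  rw [MeasurableSpace.measurableSet_bot_iff] at h
  have ht : true ∈ (f ∘ g) ⁻¹' {f x} := by simp [g]
  rcases h with h | h
  · rw [h] at ht
    exact absurd ht (Set.notMem_empty _)
  · have : false ∈ (f ∘ g) ⁻¹' {f x} := by
      rw [h]
      trivial
    simpa [g, eq_comm] using this

theorem measurableSet_cylinderEvents_cyl [MeasurableSingletonClass E] {Δ : Set (Site d)}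
    {Λ : Finset (Site d)} (h : (Λ : Set (Site d)) ⊆ Δ) (σ : Config d E) :
    MeasurableSet[cylinderEvents Δ] (cyl Λ σ) := by
  have : cyl Λ σ = ⋂ i ∈ Λ, (fun ω : Config d E => ω i) ⁻¹' {σ i} := by
    ext ω
    simp [cyl]
  rw [this]
  exact @Finset.measurableSet_biInter _ _ (cylinderEvents Δ) _ Λ fun i hi =>
    measurable_cylinderEvent_apply (h hi) (measurableSet_singleton _)

variable [Finite E] [MeasurableSingletonClass E]

theorem measurable_of_dependsOn {β : Type*} [MeasurableSpace β] [Nonempty β]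
    {Λ : Finset (Site d)} {f : Config d E → β} (hf : DependsOn f (Λ : Set (Site d))) :
    Measurable f := by
  obtain ⟨g, rfl⟩ := dependsOn_iff_exists_comp.1 hf
  exact (measurable_of_finite g).comp
    ((measurable_restrict_cylinderEvents _).mono cylinderEvents_le_pi le_rfl)

theorem integrable_of_dependsOn {μ : Measure (Config d E)} [IsFiniteMeasure μ]
    {Λ : Finset (Site d)} {f : Config d E → ℝ} (hf : DependsOn f (Λ : Set (Site d))) :
    Integrable f μ := by
  obtain ⟨C, hC⟩ := exists_bound_of_dependsOn hf
  exact Integrable.of_bound (measurable_of_dependsOn hf).aestronglyMeasurable C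
    (Eventually.of_forall hC)

theorem measurableSet_cyl (Λ : Finset (Site d)) (σ : Config d E) : MeasurableSet (cyl Λ σ) :=
  measurableSet_setOfPred.2 (measurable_of_dependsOn (dependsOn_mem_cyl Λ σ))

end LocalFunctions

/-! ### Cubes and averages over them -/

section Cubes

variable {d : ℕ}

theorem mem_cube {n : ℕ} {i : Site d} : i ∈ cube d n ↔ ∀ k, |i k| ≤ n := by
  simp only [cube, Finset.mem_Icc, Pi.le_def, abs_le, forall_and]

theorem card_cube (n : ℕ) : (cube d n).card = (2 * n + 1) ^ d := by
  rw [cube, Pi.card_Icc]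
  simp only [Int.card_Icc, Finset.prod_const, Finset.card_univ, Fintype.card_fin]
  congr 1
  omega

theorem cube_mono {m n : ℕ} (h : m ≤ n) : cube d m ⊆ cube d n := fun i hi => by
  rw [mem_cube] at *
  exact fun k => (hi k).trans (by exact_mod_cast h)

theorem add_mem_cube {m n : ℕ} {i j : Site d} (hi : i ∈ cube d m) (hj : j ∈ cube d n) :
    i + j ∈ cube d (m + n) := by
  rw [mem_cube] at *
  intro k
  push_cast
  exact (abs_add_le _ _).trans (add_le_add (hi k) (hj k))

theorem neg_mem_cube {n : ℕ} {i : Site d} (hi : i ∈ cube d n) : -i ∈ cube d n := by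
  rw [mem_cube] at *
  exact fun k => by simpa using hi k

theorem zero_mem_cube (n : ℕ) : (0 : Site d) ∈ cube d n := by
  simp [mem_cube]

theorem card_cube_pos (n : ℕ) : (0 : ℝ) < (cube d n).card := by
  rw [card_cube]
  positivity

theorem tendsto_card_cube_sub_div (m : ℕ) :
    Tendsto (fun n : ℕ => ((cube d (n - m)).card : ℝ) / (cube d n).card) atTop (𝓝 1) := by
  have h1 : Tendsto (fun n : ℕ => 1 - (2 * m : ℝ) / (2 * n + 1)) atTop (𝓝 1) := by
    have : Tendsto (fun n : ℕ => (2 * n + 1 : ℝ)) atTop atTop :=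
      tendsto_atTop_add_const_right _ _
        (tendsto_natCast_atTop_atTop.const_mul_atTop (by norm_num))
    simpa using (this.const_div_atTop (2 * m : ℝ)).const_sub 1
  have h2 := h1.pow d
  rw [one_pow] at h2
  refine h2.congr' ?_
  filter_upwards [eventually_ge_atTop m] with n hn
  rw [card_cube, card_cube]
  push_cast [hn]
  rw [← div_pow]
  congr 1
  field_simp
  ring

/-- Averages over cubes of quantities that converge uniformly in the bulk and are bounded
near the boundary. -/
theorem tendsto_average_cube {c : ℕ → Site d → ℝ} {L C : ℝ} {ε : ℕ → ℝ}
    (hε : Tendsto ε atTop (𝓝 0)) (hC : ∀ n, ∀ i ∈ cube d n, |c n i - L| ≤ C)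
    (hc : ∀ m n, m ≤ n → ∀ i ∈ cube d (n - m), |c n i - L| ≤ ε m) :
    Tendsto (fun n => (∑ i ∈ cube d n, c n i) / (cube d n).card) atTop (𝓝 L) := by
  rw [Metric.tendsto_atTop']
  intro δ hδ
  have hε0 : ∀ m, 0 ≤ ε m := fun m =>
    (abs_nonneg _).trans (hc m m le_rfl 0 (zero_mem_cube _))
  -- The depth `m` is fixed so that the bulk costs less than `δ / 2`; the layer outside `Λ_{n-m}`
  -- then costs `C` times a vanishing fraction.
  obtain ⟨m, hm⟩ := (hε.eventually (gt_mem_nhds (half_pos hδ))).exists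
  have hlim : Tendsto (fun n : ℕ => C * (1 - ((cube d (n - m)).card : ℝ) / (cube d n).card))
      atTop (𝓝 0) := by
    simpa using ((tendsto_card_cube_sub_div (d := d) m).const_sub 1).const_mul C
  obtain ⟨N, hN⟩ := eventually_atTop.1
    ((hlim.eventually (gt_mem_nhds (half_pos hδ))).and (eventually_ge_atTop m))
  refine ⟨N, fun n hn => ?_⟩
  obtain ⟨h1, h2⟩ := hN n hn.le
  have hpos := card_cube_pos (d := d) n
  have hsub : cube d (n - m) ⊆ cube d n := cube_mono (Nat.sub_le _ _)
  have hle : |∑ i ∈ cube d n, (c n i - L)| ≤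
      (cube d (n - m)).card * ε m + ((cube d n).card - (cube d (n - m)).card) * C := by
    refine (Finset.abs_sum_le_sum_abs _ _).trans ?_
    rw [← Finset.sum_sdiff hsub, add_comm]
    refine add_le_add ?_ ?_
    · rw [← nsmul_eq_mul]
      exact Finset.sum_le_card_nsmul _ _ _ fun i hi => hc m n h2 i hi
    · rw [← Nat.cast_sub (Finset.card_le_card hsub), ← Finset.card_sdiff_of_subset hsub,
        ← nsmul_eq_mul]
      exact Finset.sum_le_card_nsmul _ _ _ fun i hi => hC n i (Finset.mem_sdiff.1 hi).1
  have heq : (∑ i ∈ cube d n, c n i) / (cube d n).card - L =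
      (∑ i ∈ cube d n, (c n i - L)) / (cube d n).card := by
    rw [Finset.sum_sub_distrib, Finset.sum_const, nsmul_eq_mul]
    field_simp
  rw [Real.dist_eq, heq, abs_div, abs_of_pos hpos, div_lt_iff₀ hpos]
  refine hle.trans_lt ?_
  have h3 : ((cube d (n - m)).card : ℝ) * ε m ≤ (cube d n).card * ε m :=
    mul_le_mul_of_nonneg_right (by exact_mod_cast Finset.card_le_card hsub) (hε0 m)
  have h4 : ((cube d n).card - (cube d (n - m)).card : ℝ) * C =
      C * (1 - ((cube d (n - m)).card : ℝ) / (cube d n).card) * (cube d n).card := by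
    field_simp
  have h5 := mul_lt_mul_of_pos_right h1 hpos
  have h6 := mul_lt_mul_of_pos_right hm hpos
  rw [h4]
  linarith

end Cubes

/-! ### Telescoping along the lexicographic order -/

section LexicographicOrder

variable {d : ℕ}

open Classical in
/-- The sites of `Λ` that come after `i` in the lexicographic order, and `i` itself. -/
noncomputable def fromSite (Λ : Finset (Site d)) (i : Site d) : Finset (Site d) :=
  Λ.filter fun j => toLex i ≤ toLex j

open Classical in
/-- The sites of `Λ` that come after `i` in the lexicographic order. -/
noncomputable def afterSite (Λ : Finset (Site d)) (i : Site d) : Finset (Site d) :=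
  Λ.filter fun j => toLex i < toLex j

theorem mem_fromSite {Λ : Finset (Site d)} {i j : Site d} :
    j ∈ fromSite Λ i ↔ j ∈ Λ ∧ toLex i ≤ toLex j := by
  classical
  exact Finset.mem_filter

theorem mem_afterSite {Λ : Finset (Site d)} {i j : Site d} :
    j ∈ afterSite Λ i ↔ j ∈ Λ ∧ toLex i < toLex j := by
  classical
  exact Finset.mem_filter

theorem fromSite_eq_insert {Λ : Finset (Site d)} {i : Site d} (hi : i ∈ Λ) :
    fromSite Λ i = insert i (afterSite Λ i) := by
  ext j
  rw [Finset.mem_insert, mem_fromSite, mem_afterSite, le_iff_eq_or_lt, toLex_inj]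
  constructor
  · rintro ⟨h, rfl | h'⟩
    · exact Or.inl rfl
    · exact Or.inr ⟨h, h'⟩
  · rintro (rfl | ⟨h, h'⟩)
    · exact ⟨hi, Or.inl rfl⟩
    · exact ⟨h, Or.inr h'⟩

theorem zero_le_toLex_sub {i j : Site d} : toLex (0 : Site d) ≤ toLex (j - i) ↔
    toLex i ≤ toLex j := by
  rw [toLex_sub, toLex_zero, sub_nonneg]

theorem zero_lt_toLex_sub {i j : Site d} : toLex (0 : Site d) < toLex (j - i) ↔
    toLex i < toLex j := by
  rw [toLex_sub, toLex_zero, sub_pos]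

/-- A set function is the sum of its increments along the lexicographic order. -/
theorem sum_increments (V : Finset (Site d) → ℝ) (Λ : Finset (Site d)) :
    ∑ i ∈ Λ, (V (fromSite Λ i) - V (afterSite Λ i)) = V Λ - V ∅ := by
  classical
  -- The inserted site precedes all others, so it enters none of their sets `fromSite` and
  -- `afterSite`.
  induction Λ using Finset.induction_on_min_value (toLex : Site d → Lex (Site d)) with
  | empty => simp
  | insert a s ha hmin ih =>
    have hlt : ∀ x ∈ s, toLex a < toLex x := fun x hx =>
      lt_of_le_of_ne (hmin x hx) fun h => ha (by rwa [toLex_inj.1 h])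
    rw [Finset.sum_insert ha]
    have h1 : fromSite (insert a s) a = insert a s := by
      ext j
      rw [mem_fromSite, and_iff_left_iff_imp, Finset.mem_insert]
      rintro (rfl | h)
      · exact le_rfl
      · exact hmin j h
    have h2 : afterSite (insert a s) a = s := by
      ext j
      rw [mem_afterSite, Finset.mem_insert]
      constructor
      · rintro ⟨rfl | h, h'⟩
        · exact absurd h' (lt_irrefl _)
        · exact h
      · exact fun h => ⟨Or.inr h, hlt j h⟩
    have h3 : ∀ i ∈ s, V (fromSite (insert a s) i) - V (afterSite (insert a s) i) =
        V (fromSite s i) - V (afterSite s i) := by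
      intro i hi
      congr 2
      · ext j
        rw [mem_fromSite, mem_fromSite, Finset.mem_insert]
        constructor
        · rintro ⟨rfl | h, h'⟩
          · exact absurd h' (not_le.2 (hlt i hi))
          · exact ⟨h, h'⟩
        · exact fun h => ⟨Or.inr h.1, h.2⟩
      · ext j
        rw [mem_afterSite, mem_afterSite, Finset.mem_insert]
        constructor
        · rintro ⟨rfl | h, h'⟩
          · exact absurd h' (not_lt.2 (hlt i hi).le)
          · exact ⟨h, h'⟩
        · exact fun h => ⟨Or.inr h.1, h.2⟩
    rw [Finset.sum_congr rfl h3, ih, h1, h2]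
    ring

end LexicographicOrder

/-! ### Strong subadditivity and existence of the entropy density -/

section Entropy

theorem integral_comp_eq_sum {Ω α : Type*} [MeasurableSpace Ω] [Fintype α] [MeasurableSpace α]
    [MeasurableSingletonClass α] (μ : Measure Ω) [IsFiniteMeasure μ] {X : Ω → α}
    (hX : Measurable X) (g : α → ℝ) :
    ∫ ω, g (X ω) ∂μ = ∑ x, μ.real (X ⁻¹' {x}) * g x := by
  rw [← integral_map hX.aemeasurable (measurable_of_finite g).aestronglyMeasurable,
    integral_fintype (.of_finite)]
  refine Finset.sum_congr rfl fun x _ => ?_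
  rw [map_measureReal_apply hX (measurableSet_singleton x), smul_eq_mul]

/-- The finitely many null fibres have null union. This legitimates the logarithms of
`μ`-probabilities, although `μ` may give some cylinders mass zero. -/
theorem ae_measureReal_fiber_pos {Ω α : Type*} [MeasurableSpace Ω] [Finite α]
    (μ : Measure Ω) [IsFiniteMeasure μ] (X : Ω → α) :
    ∀ᵐ ω ∂μ, 0 < μ.real (X ⁻¹' {X ω}) := by
  have h : ∀ x, ∀ᵐ ω ∂μ, X ω = x → 0 < μ.real (X ⁻¹' {x}) := by
    intro x
    by_cases hx : μ.real (X ⁻¹' {x}) = 0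
    · rw [measureReal_eq_zero_iff] at hx
      filter_upwards [measure_eq_zero_iff_ae_notMem.1 hx] with ω hω h
      exact absurd h hω
    · exact Eventually.of_forall fun _ _ => lt_of_le_of_ne measureReal_nonneg (Ne.symm hx)
  filter_upwards [ae_all_iff.2 h] with ω hω using hω _ rfl

variable {d : ℕ} {E : Type*}

theorem restrict_preimage_singleton (Λ : Finset (Site d)) (ω : Config d E) :
    Λ.restrict (π := fun _ => E) ⁻¹' {Λ.restrict ω} = cyl Λ ω := by
  ext σ
  simp [cyl, funext_iff]

theorem cyl_shift (x : Site d) (Λ : Finset (Site d)) (ω : Config d E) :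
    shift x ⁻¹' cyl (Λ.map (addRightEmbedding x)) (shift x ω) = cyl Λ ω := by
  ext σ
  simp [cyl, shift]

variable [MeasurableSpace E]

/-- The entropy of the marginal of `μ` in `Λ`. -/
noncomputable def blockEntropy (μ : Measure (Config d E)) (Λ : Finset (Site d)) : ℝ :=
  ∫ ω, -Real.log (μ.real (cyl Λ ω)) ∂μ

theorem ae_measureReal_cyl_pos [Finite E] (μ : Measure (Config d E)) [IsFiniteMeasure μ]
    (Λ : Finset (Site d)) : ∀ᵐ ω ∂μ, 0 < μ.real (cyl Λ ω) := by
  simpa only [restrict_preimage_singleton] using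
    ae_measureReal_fiber_pos μ (Λ.restrict (π := fun _ => E))

theorem integrable_comp_cyl [Finite E] [MeasurableSingletonClass E] (μ : Measure (Config d E))
    [IsFiniteMeasure μ] (Λ : Finset (Site d)) (F : Set (Config d E) → ℝ) :
    Integrable (fun ω => F (cyl Λ ω)) μ :=
  integrable_of_dependsOn (dependsOn_comp_cyl Λ F)

theorem entropyPerSite_eq [Fintype E] [MeasurableSingletonClass E] (μ : Measure (Config d E))
    [IsFiniteMeasure μ] (n : ℕ) :
    entropyPerSite μ n = blockEntropy μ (cube d n) / (cube d n).card := by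
  have h := integral_comp_eq_sum μ (Finset.measurable_restrict (X := fun _ => E) (cube d n))
    fun η => -Real.log (μ.real ((cube d n).restrict ⁻¹' {η}))
  simp only [restrict_preimage_singleton] at h
  rw [entropyPerSite, blockEntropy, h]
  congr 1
  refine Finset.sum_congr rfl fun η _ => ?_
  rw [Real.negMulLog]
  ring

theorem measurable_shift (x : Site d) : Measurable (shift x : Config d E → Config d E) :=
  measurable_pi_lambda _ fun _ => measurable_pi_apply _

theorem blockEntropy_map_add [Finite E] [MeasurableSingletonClass E] {μ : Measure (Config d E)}
    [IsFiniteMeasure μ] (hμ : IsTranslationInvariant μ) (x : Site d) (Λ : Finset (Site d)) :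
    blockEntropy μ (Λ.map (addRightEmbedding x)) = blockEntropy μ Λ := by
  rw [blockEntropy]
  conv_lhs => rw [← hμ x]
  rw [integral_map (measurable_shift x).aemeasurable (integrable_comp_cyl _ _
    fun A => -Real.log ((μ.map (shift x)).real A)).aestronglyMeasurable, blockEntropy]
  refine integral_congr_ae (Eventually.of_forall fun ω => ?_)
  simp only [map_measureReal_apply (measurable_shift x) (measurableSet_cyl _ _), cyl_shift]

theorem blockEntropy_mono [Finite E] [MeasurableSingletonClass E] (μ : Measure (Config d E))
    [IsFiniteMeasure μ] {S T : Finset (Site d)} (h : S ⊆ T) :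
    blockEntropy μ S ≤ blockEntropy μ T := by
  refine integral_mono_ae (integrable_comp_cyl μ S fun A => -Real.log (μ.real A))
    (integrable_comp_cyl μ T fun A => -Real.log (μ.real A)) ?_
  filter_upwards [ae_measureReal_cyl_pos μ T] with ω hω
  exact neg_le_neg (Real.log_le_log hω (measureReal_mono fun σ hσ i hi => hσ i (h hi)))

/-- The integrand is `μ(ω_i | ω_S) / μ(ω_i | ω_T)`. Against `μ` the denominator cancels, and `μ(ω_T)
μ(ω_i | ω_S)` sums to at most one. -/
theorem integral_cyl_ratio_le_one [Finite E] [MeasurableSingletonClass E]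
    (μ : Measure (Config d E)) [IsProbabilityMeasure μ] {S T : Finset (Site d)} (h : S ⊆ T)
    (i : Site d) :
    ∫ ω, μ.real (cyl (insert i S) ω) * μ.real (cyl T ω) /
      (μ.real (cyl (insert i T) ω) * μ.real (cyl S ω)) ∂μ ≤ 1 := by
  have := Fintype.ofFinite E
  let rS : Config d E → S → E := S.restrict
  let rT : Config d E → T → E := T.restrict
  -- The spin at `i` is recorded separately, so that `i` may belong to `S` or `T`.
  let X : Config d E → (T → E) × E := fun ω => (T.restrict ω, ω i)
  let Y : Config d E → (S → E) × E := fun ω => (S.restrict ω, ω i)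
  have hX : Measurable X := (Finset.measurable_restrict T).prodMk (measurable_pi_apply i)
  have hcylX : ∀ ω, X ⁻¹' {X ω} = cyl (insert i T) ω := by
    intro ω
    ext σ
    simp only [cyl, Set.mem_ofPred_eq, Finset.forall_mem_insert]
    simp [X, funext_iff, and_comm]
  have hcylY : ∀ ω, Y ⁻¹' {(Finset.restrict₂ (π := fun _ => E) h (X ω).1, (X ω).2)} =
      cyl (insert i S) ω := by
    intro ω
    ext σ
    simp only [cyl, Set.mem_ofPred_eq, Finset.forall_mem_insert]
    simp [X, Y, funext_iff, and_comm]
  have hT : ∀ ω, rT ⁻¹' {(X ω).1} = cyl T ω := restrict_preimage_singleton T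
  have hS : ∀ ω, rS ⁻¹' {Finset.restrict₂ (π := fun _ => E) h (X ω).1} = cyl S ω :=
    restrict_preimage_singleton S
  have hsum := integral_comp_eq_sum μ hX fun x =>
    μ.real (Y ⁻¹' {(Finset.restrict₂ (π := fun _ => E) h x.1, x.2)}) * μ.real (rT ⁻¹' {x.1}) /
      (μ.real (X ⁻¹' {x}) * μ.real (rS ⁻¹' {Finset.restrict₂ (π := fun _ => E) h x.1}))
  simp only [hcylX, hcylY, hT, hS] at hsum
  rw [hsum, Fintype.sum_prod_type]
  have hY : ∀ s : S → E, ∑ a, μ.real (Y ⁻¹' {(s, a)}) = μ.real (rS ⁻¹' {s}) := by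
    intro s
    have := integral_comp_eq_sum (μ.restrict (rS ⁻¹' {s}))
      (measurable_pi_apply (X := fun _ : Site d => E) i) fun _ => 1
    simp only [integral_const, mul_one, smul_eq_mul, measureReal_restrict_apply_univ] at this
    rw [this]
    refine Finset.sum_congr rfl fun a _ => ?_
    rw [measureReal_restrict_apply (measurable_pi_apply i (measurableSet_singleton a))]
    congr 1
    ext σ
    simp [Y, rS, and_comm]
  calc _ ≤ ∑ t : T → E, μ.real (rT ⁻¹' {t}) := by
        refine Finset.sum_le_sum fun t _ => ?_
        set s := Finset.restrict₂ (π := fun _ => E) h t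
        calc _ ≤ ∑ a, μ.real (rT ⁻¹' {t}) / μ.real (rS ⁻¹' {s}) *
                μ.real (Y ⁻¹' {(s, a)}) := by
              refine Finset.sum_le_sum fun a _ => ?_
              -- A null atom contributes zero on the left but possibly a positive term on the right:
              -- here equality may fail.
              by_cases h0 : μ.real (X ⁻¹' {(t, a)}) = 0
              · rw [h0, zero_mul]
                positivity
              · refine le_of_eq ?_
                field_simp
                rw [mul_comm]
          _ = μ.real (rT ⁻¹' {t}) / μ.real (rS ⁻¹' {s}) *
                μ.real (rS ⁻¹' {s}) := by
              rw [← Finset.mul_sum, hY]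
          _ ≤ _ := by
              by_cases h0 : μ.real (rS ⁻¹' {s}) = 0
              · simp [h0]
              · exact (div_mul_cancel₀ _ h0).le
    _ = 1 := by
        have := integral_comp_eq_sum μ (Finset.measurable_restrict (X := fun _ => E) T) fun _ => 1
        simpa using this.symm

/-- Strong subadditivity of the entropy: the increments of the entropy are decreasing. -/
theorem blockEntropy_insert_sub_anti [Finite E] [MeasurableSingletonClass E]
    (μ : Measure (Config d E)) [IsProbabilityMeasure μ] {S T : Finset (Site d)} (h : S ⊆ T)
    (i : Site d) :
    blockEntropy μ (insert i T) - blockEntropy μ T ≤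
      blockEntropy μ (insert i S) - blockEntropy μ S := by
  have hlog := fun Λ => integrable_comp_cyl μ Λ fun A => -Real.log (μ.real A)
  have hg : Integrable (fun ω => μ.real (cyl (insert i S) ω) * μ.real (cyl T ω) /
      (μ.real (cyl (insert i T) ω) * μ.real (cyl S ω))) μ := by
    refine integrable_of_dependsOn (Λ := insert i T) fun x y hxy => ?_
    have hxy' : ∀ j ∈ insert i T, x j = y j := fun j hj => hxy j hj
    simp only [cyl_congr hxy', cyl_congr fun j hj => hxy' j (Finset.mem_insert_of_mem hj),
      cyl_congr fun j hj => hxy' j (Finset.mem_insert_of_mem (h hj)),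
      cyl_congr fun j hj => hxy' j (Finset.insert_subset_insert i h hj)]
  -- This integrates `1 - r ≤ -log r`, where `r` is the ratio of conditional probabilities.
  have key : ∫ ω, (1 - μ.real (cyl (insert i S) ω) * μ.real (cyl T ω) /
      (μ.real (cyl (insert i T) ω) * μ.real (cyl S ω))) ∂μ ≤
      ∫ ω, ((-Real.log (μ.real (cyl (insert i S) ω)) - -Real.log (μ.real (cyl S ω))) -
        (-Real.log (μ.real (cyl (insert i T) ω)) - -Real.log (μ.real (cyl T ω)))) ∂μ := by
    refine integral_mono_ae ((integrable_const _).sub hg)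
      (((hlog _).sub (hlog _)).sub ((hlog _).sub (hlog _))) ?_
    filter_upwards [ae_measureReal_cyl_pos μ S, ae_measureReal_cyl_pos μ T,
      ae_measureReal_cyl_pos μ (insert i S), ae_measureReal_cyl_pos μ (insert i T)]
      with ω h1 h2 h3 h4
    have := Real.log_le_sub_one_of_pos (div_pos (mul_pos h3 h2) (mul_pos h4 h1))
    rw [Real.log_div (mul_pos h3 h2).ne' (mul_pos h4 h1).ne', Real.log_mul h3.ne' h2.ne',
      Real.log_mul h4.ne' h1.ne'] at this
    linarith
  have hsub : ∀ A B : Finset (Site d), Integrable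
      (fun ω => -Real.log (μ.real (cyl A ω)) - -Real.log (μ.real (cyl B ω))) μ :=
    fun A B => (hlog A).sub (hlog B)
  rw [integral_sub (integrable_const _) hg, integral_sub (hsub _ _) (hsub _ _),
    integral_sub (hlog _) (hlog _), integral_sub (hlog _) (hlog _)] at key
  have h1 := integral_cyl_ratio_le_one μ h i
  simp only [integral_const, probReal_univ, smul_eq_mul, mul_one] at key
  simp only [blockEntropy]
  linarith

/-- The entropy density of a translation-invariant measure exists. -/
theorem exists_hasEntropy [Fintype E] [MeasurableSingletonClass E] {μ : Measure (Config d E)}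
    [IsProbabilityMeasure μ] (hμ : IsTranslationInvariant μ) : ∃ h, HasEntropy μ h := by
  let inc : Finset (Site d) → ℝ := fun S => blockEntropy μ (insert 0 S) - blockEntropy μ S
  have hinc : ∀ S, 0 ≤ inc S := fun S => sub_nonneg.2 (blockEntropy_mono μ (Finset.subset_insert _ _))
  have hanti : ∀ {S T}, S ⊆ T → inc T ≤ inc S := fun h => blockEntropy_insert_sub_anti μ h 0
  let P : ℕ → Finset (Site d) := fun m => afterSite (cube d m) 0
  have hP : Antitone fun m => inc (P m) := fun m n hmn => hanti fun j hj => by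
    rw [mem_afterSite] at *
    exact ⟨cube_mono hmn hj.1, hj.2⟩
  have hbdd : BddBelow (Set.range fun m => inc (P m)) :=
    ⟨0, by rintro _ ⟨m, rfl⟩; exact hinc _⟩
  have hlim := tendsto_atTop_ciInf hP hbdd
  set h := ⨅ m, inc (P m)
  have hlow : ∀ m, h ≤ inc (P m) := fun m => ciInf_le hbdd m
  let c : ℕ → Site d → ℝ := fun n i =>
    blockEntropy μ (fromSite (cube d n) i) - blockEntropy μ (afterSite (cube d n) i)
  -- Seen from `i`, the increment is the conditional entropy of the origin given `Q n i`. This set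
  -- lies in `P (2n)` and, at depth `m`, contains `P m`, so monotonicity squeezes the increment
  -- between `h` and `inc (P m)`.
  let Q : ℕ → Site d → Finset (Site d) := fun n i =>
    (afterSite (cube d n) i).map (addRightEmbedding (-i))
  have hc : ∀ n, ∀ i ∈ cube d n, c n i = inc (Q n i) := by
    intro n i hi
    simp only [c, inc, Q]
    rw [fromSite_eq_insert hi, ← blockEntropy_map_add hμ (-i), Finset.map_insert,
      ← blockEntropy_map_add hμ (-i) (afterSite _ _)]
    simp
  have hQ : ∀ n i j, j ∈ Q n i ↔ j + i ∈ cube d n ∧ toLex (0 : Site d) < toLex j := by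
    intro n i j
    have : toLex (0 : Site d) < toLex j ↔ toLex i < toLex (j + i) := by
      rw [← zero_lt_toLex_sub (i := i), add_sub_cancel_right]
    simp only [Q, Finset.mem_map, mem_afterSite, addRightEmbedding_apply]
    constructor
    · rintro ⟨k, hk, rfl⟩
      simpa [this] using hk
    · exact fun hj => ⟨j + i, ⟨hj.1, this.1 hj.2⟩, by simp⟩
  have hge : ∀ n, ∀ i ∈ cube d n, h ≤ inc (Q n i) := by
    intro n i hi
    refine (hlow (n + n)).trans (hanti fun j hj => ?_)
    rw [hQ] at hj
    refine mem_afterSite.2 ⟨?_, hj.2⟩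
    simpa using add_mem_cube hj.1 (neg_mem_cube hi)
  refine ⟨h, ?_⟩
  have hav := tendsto_average_cube (c := c) (L := h) (C := inc ∅ - h)
    (ε := fun m => inc (P m) - h) (by simpa using hlim.sub_const h) ?_ ?_
  · refine hav.congr fun n => ?_
    rw [entropyPerSite_eq, sum_increments, sub_eq_self.2]
    simp [blockEntropy, cyl]
  · intro n i hi
    rw [hc n i hi, abs_of_nonneg (sub_nonneg.2 (hge n i hi))]
    exact sub_le_sub_right (hanti (Finset.empty_subset _)) _
  · intro m n hmn i hi
    have hi' := cube_mono (Nat.sub_le _ _) hi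
    rw [hc n i hi', abs_of_nonneg (sub_nonneg.2 (hge n i hi'))]
    refine sub_le_sub_right (hanti fun j hj => ?_) _
    rw [mem_afterSite] at hj
    rw [hQ]
    refine ⟨?_, hj.2⟩
    simpa [hmn] using add_mem_cube hj.1 hi

end Entropy

/-! ### DLR equations and ratios of cylinders differing at one site -/

section SingleSite

variable {d : ℕ} {E : Type*} [MeasurableSpace E]

namespace Specification

variable (γ : Specification d E)

theorem prob_congr {Λ : Finset (Site d)} {σ τ : Config d E} (h : ∀ i ∈ Λ, σ i = τ i)
    (ω : Config d E) : γ.prob Λ σ ω = γ.prob Λ τ ω := by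
  rw [prob, prob, cyl_congr h]

theorem prob_nonneg (Λ : Finset (Site d)) (σ ω : Config d E) : 0 ≤ γ.prob Λ σ ω :=
  measureReal_nonneg

theorem prob_le_one (Λ : Finset (Site d)) (σ ω : Config d E) : γ.prob Λ σ ω ≤ 1 :=
  have := γ.isMarkov Λ
  measureReal_le_one

/-- By properness `γ_Λ(B | ω)` is 1 on `B` and 0 off it, so `γ_Λ(B ∩ A | ω)` is `γ_Λ(A | ω)` cut off
to `B`. -/
theorem measure_inter {ν : Measure (Config d E)} (hν : γ.IsDLR ν) (Λ : Finset (Site d))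
    {A B : Set (Config d E)} (hA : MeasurableSet A)
    (hB : MeasurableSet[cylinderEvents ((Λ : Set (Site d))ᶜ)] B) :
    ν (B ∩ A) = ∫⁻ ω in B, γ.ker Λ ω A ∂ν := by
  have := γ.isMarkov Λ
  have hB' : MeasurableSet B := cylinderEvents_le_pi _ hB
  conv_lhs => rw [← hν.2 Λ]
  rw [Measure.bind_apply (hB'.inter hA) (γ.ker Λ).aemeasurable, ← lintegral_indicator hB']
  refine lintegral_congr fun ω => ?_
  have hprop := γ.proper Λ B hB ω
  by_cases hω : ω ∈ B
  · rw [Set.indicator_of_mem hω] at hprop ⊢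
    have h0 : γ.ker Λ ω Bᶜ = 0 := (prob_compl_eq_zero_iff hB').2 hprop
    rw [Set.inter_comm]
    exact measure_inter_conull h0
  · rw [Set.indicator_of_notMem hω] at hprop ⊢
    exact measure_mono_null Set.inter_subset_left hprop

variable [Finite E] [MeasurableSingletonClass E]

theorem dependsOn_prob (Λ : Finset (Site d)) (σ : Config d E) :
    DependsOn (γ.prob Λ σ) ((Λ : Set (Site d))ᶜ) := fun _ _ h =>
  congrArg ENNReal.toReal (dependsOn_of_measurable_cylinderEvents
    (γ.measurable_outside Λ _ (measurableSet_cyl Λ σ)) h)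

theorem measurable_prob (Λ : Finset (Site d)) (σ : Config d E) : Measurable (γ.prob Λ σ) :=
  ((γ.ker Λ).measurable_coe (measurableSet_cyl Λ σ)).ennreal_toReal

variable {γ} in
theorem IsTranslationInvariant.prob_shift (hγ : γ.IsTranslationInvariant) (x : Site d)
    (Λ : Finset (Site d)) (σ ω : Config d E) :
    γ.prob (Λ.map (addRightEmbedding x)) (shift x σ) (shift x ω) = γ.prob Λ σ ω := by
  rw [prob, ← hγ, map_measureReal_apply (measurable_shift x) (measurableSet_cyl _ _), cyl_shift,
    prob]

theorem measureReal_cyl_inter {ν : Measure (Config d E)} (hν : γ.IsDLR ν)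
    {Λ S : Finset (Site d)} (h : Disjoint S Λ) (σ ξ : Config d E) :
    ν.real (cyl S ξ ∩ cyl Λ σ) = ∫ ω in cyl S ξ, γ.prob Λ σ ω ∂ν := by
  have := γ.isMarkov Λ
  rw [measureReal_def, γ.measure_inter hν Λ (measurableSet_cyl Λ σ)
    (measurableSet_cylinderEvents_cyl
      (Set.subset_compl_iff_disjoint_right.2 (Finset.disjoint_coe.2 h)) ξ)]
  exact (integral_toReal ((γ.ker Λ).measurable_coe (measurableSet_cyl Λ σ)).aemeasurable
    (Eventually.of_forall fun ω => measure_lt_top _ _)).symm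

theorem integrable_prob (ν : Measure (Config d E)) [IsFiniteMeasure ν] (Λ : Finset (Site d))
    (σ : Config d E) : Integrable (γ.prob Λ σ) ν :=
  Integrable.of_bound (γ.measurable_prob Λ σ).aestronglyMeasurable 1
    (Eventually.of_forall fun ω => by
      rw [Real.norm_of_nonneg (γ.prob_nonneg Λ σ ω)]
      exact γ.prob_le_one Λ σ ω)

variable {γ} in
theorem IsUniformlyNonNull.exists_le_prob [Nonempty E] (hγ : γ.IsUniformlyNonNull)
    (Λ : Finset (Site d)) : ∃ c : ℝ, 0 < c ∧ ∀ σ ω, c ≤ γ.prob Λ σ ω := by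
  have := Fintype.ofFinite E
  have := γ.isMarkov Λ
  obtain ⟨α, β, hα, -, h⟩ := hγ Λ
  -- A cylinder over `Λ` has a priori mass `|E|^{-|Λ|}`.
  refine ⟨α * ((Fintype.card E : ℝ)⁻¹) ^ Λ.card, by positivity, fun σ ω => ?_⟩
  have h1 := (h ω (cyl Λ σ) (measurableSet_cylinderEvents_cyl subset_rfl σ)).1
  have h2 : apriori d E (cyl Λ σ) = ((Fintype.card E : ℝ≥0∞)⁻¹) ^ Λ.card := by
    have hcyl : cyl Λ σ = Set.pi (Λ : Set (Site d)) fun i => {σ i} := by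
      ext
      simp [cyl]
    rw [hcyl, apriori, Measure.infinitePi_pi _ fun i _ => measurableSet_singleton _]
    simp [uniformOn_univ]
  rw [h2] at h1
  have h3 := ENNReal.toReal_mono (measure_ne_top _ _) h1
  rwa [ENNReal.toReal_mul, ENNReal.toReal_ofReal hα.le, ENNReal.toReal_pow, ENNReal.toReal_inv,
    ENNReal.toReal_natCast] at h3

variable {γ} in
theorem IsUniformlyNonNull.measureReal_cyl_pos [Nonempty E] (hγ : γ.IsUniformlyNonNull)
    {ν : Measure (Config d E)} (hν : γ.IsDLR ν) (Λ : Finset (Site d)) (σ : Config d E) :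
    0 < ν.real (cyl Λ σ) := by
  have := hν.1
  obtain ⟨c, hc, h⟩ := hγ.exists_le_prob Λ
  have h1 := γ.measureReal_cyl_inter hν (Finset.disjoint_empty_left Λ) σ σ
  have h2 : cyl ∅ σ = Set.univ := by simp [cyl]
  rw [h2, Set.univ_inter, setIntegral_univ] at h1
  rw [h1]
  refine hc.trans_le ?_
  simpa using integral_mono (integrable_const c) (γ.integrable_prob ν Λ σ) (h σ)

variable {γ} in
-- Both masses are integrals of single-site probabilities over the same event outside `i`, so a
-- pointwise bound on the ratio of the integrands passes to the integrals.
theorem IsUniformlyNonNull.log_ratio_le [Nonempty E] (hγ : γ.IsUniformlyNonNull)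
    {ν : Measure (Config d E)} (hν : γ.IsDLR ν) {Λ : Finset (Site d)} {i : Site d} (hi : i ∈ Λ)
    {σ τ : Config d E} (hστ : ∀ j ∈ Λ, j ≠ i → σ j = τ j) {M : ℝ}
    (hM : ∀ ω ∈ cyl (Λ.erase i) σ, Real.log (γ.prob {i} σ ω / γ.prob {i} τ ω) ≤ M) :
    Real.log (ν.real (cyl Λ σ) / ν.real (cyl Λ τ)) ≤ M := by
  have := hν.1
  obtain ⟨c, hc, hle⟩ := hγ.exists_le_prob {i}
  have hcyl : ∀ ρ : Config d E, cyl Λ ρ = cyl (Λ.erase i) ρ ∩ cyl {i} ρ := by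
    intro ρ
    conv_lhs => rw [← Finset.insert_erase hi]
    ext ω
    simp only [cyl, Set.mem_inter_iff, Set.mem_ofPred_eq, Finset.forall_mem_insert,
      Finset.mem_singleton, forall_eq]
    exact and_comm
  have hdisj : Disjoint (Λ.erase i) {i} := by simp
  have hτ : cyl (Λ.erase i) τ = cyl (Λ.erase i) σ :=
    (cyl_congr fun j hj => hστ j (Finset.mem_of_mem_erase hj) (Finset.ne_of_mem_erase hj)).symm
  have hpos := hγ.measureReal_cyl_pos hν Λ
  rw [Real.log_le_iff_le_exp (div_pos (hpos _) (hpos _)), div_le_iff₀ (hpos _), hcyl σ, hcyl τ, hτ,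
    γ.measureReal_cyl_inter hν hdisj, γ.measureReal_cyl_inter hν hdisj, ← integral_const_mul]
  refine setIntegral_mono_on (γ.integrable_prob ν _ _).integrableOn
    ((γ.integrable_prob ν _ _).const_mul _).integrableOn (measurableSet_cyl _ _) fun ω hω => ?_
  have h1 := hc.trans_le (hle σ ω)
  have h2 := hc.trans_le (hle τ ω)
  have h3 := hM ω hω
  rwa [Real.log_le_iff_le_exp (div_pos h1 h2), div_le_iff₀ h2] at h3

variable {γ} in
theorem IsUniformlyNonNull.abs_log_ratio_sub_le [Nonempty E] (hγ : γ.IsUniformlyNonNull)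
    {ν : Measure (Config d E)} (hν : γ.IsDLR ν) {Λ : Finset (Site d)} {i : Site d} (hi : i ∈ Λ)
    {σ τ : Config d E} (hστ : ∀ j ∈ Λ, j ≠ i → σ j = τ j) {L K : ℝ}
    (hK : ∀ ω ∈ cyl (Λ.erase i) σ, |Real.log (γ.prob {i} σ ω / γ.prob {i} τ ω) - L| ≤ K) :
    |Real.log (ν.real (cyl Λ σ)) - Real.log (ν.real (cyl Λ τ)) - L| ≤ K := by
  have hpos := fun ρ => (hγ.measureReal_cyl_pos hν Λ ρ).ne'
  have hcyl : cyl (Λ.erase i) σ = cyl (Λ.erase i) τ :=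
    cyl_congr fun j hj => hστ j (Finset.mem_of_mem_erase hj) (Finset.ne_of_mem_erase hj)
  have h1 := hγ.log_ratio_le hν hi hστ (M := L + K) fun ω hω => by
    linarith [(abs_le.1 (hK ω hω)).2]
  -- The lower bound is the upper one with `σ` and `τ` exchanged.
  have h2 := hγ.log_ratio_le hν hi (fun j hj hji => (hστ j hj hji).symm) (M := K - L)
    fun ω hω => by
      have := (abs_le.1 (hK ω (hcyl ▸ hω))).1
      rw [← inv_div, Real.log_inv]
      linarith
  rw [Real.log_div (hpos _) (hpos _)] at h1 h2
  rw [abs_le]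
  constructor <;> linarith

end Specification

end SingleSite

/-! ### Oscillations and points of continuity -/

section Oscillation

variable {d : ℕ} {E : Type*}

/-- The oscillation of `f` over the configurations that agree with `ω` in `Λ_m`. -/
noncomputable def oscillation (f : Config d E → ℝ) (m : ℕ) (ω : Config d E) : ℝ :=
  ⨆ τ : Config d E × Config d E, |f (glue (cube d m) ω τ.1) - f (glue (cube d m) ω τ.2)|

variable {f : Config d E → ℝ}

theorem oscillation_nonneg (m : ℕ) (ω : Config d E) : 0 ≤ oscillation f m ω :=
  Real.iSup_nonneg fun _ => abs_nonneg _

theorem abs_sub_le_one (hf : ∀ ω, f ω ∈ Set.Icc (0 : ℝ) 1) (σ τ : Config d E) :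
    |f σ - f τ| ≤ 1 := by
  have h1 := hf σ
  have h2 := hf τ
  rw [Set.mem_Icc] at h1 h2
  rw [abs_le]
  constructor <;> linarith

theorem oscillation_le_one (hf : ∀ ω, f ω ∈ Set.Icc (0 : ℝ) 1) (m : ℕ) (ω : Config d E) :
    oscillation f m ω ≤ 1 :=
  Real.iSup_le (fun _ => abs_sub_le_one hf _ _) zero_le_one

/-- Locality makes this uncountable supremum measurable. -/
theorem dependsOn_oscillation (f : Config d E → ℝ) (m : ℕ) :
    DependsOn (oscillation f m) (cube d m : Set (Site d)) := by
  intro x y h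
  have : ∀ σ, glue (cube d m) x σ = glue (cube d m) y σ := by
    intro σ
    funext i
    by_cases hi : i ∈ cube d m
    · simp [glue, hi, h i hi]
    · simp [glue, hi]
  simp only [oscillation, this]

theorem glue_eq_of_eqOn {Λ : Finset (Site d)} {ω σ : Config d E} (h : ∀ i ∈ Λ, σ i = ω i) :
    glue Λ ω σ = σ := by
  funext i
  by_cases hi : i ∈ Λ
  · simp [glue, hi, h i hi]
  · simp [glue, hi]

theorem abs_sub_le_oscillation (hf : ∀ ω, f ω ∈ Set.Icc (0 : ℝ) 1) {m : ℕ} {ω σ : Config d E}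
    (h : ∀ i ∈ cube d m, σ i = ω i) : |f σ - f ω| ≤ oscillation f m ω := by
  -- Boundedness is needed because an unbounded real supremum is 0 by convention.
  have hb : BddAbove (Set.range fun τ : Config d E × Config d E =>
      |f (glue (cube d m) ω τ.1) - f (glue (cube d m) ω τ.2)|) :=
    ⟨1, by rintro _ ⟨τ, rfl⟩; exact abs_sub_le_one hf _ _⟩
  have := le_ciSup hb (σ, ω)
  simpa only [oscillation, glue_eq_of_eqOn h, glue_eq_of_eqOn fun i (_ : i ∈ cube d m) => rfl]
    using this

/-- Both configurations are compared with `ω`, which costs a factor 2. -/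
theorem tendsto_oscillation (hf : ∀ ω, f ω ∈ Set.Icc (0 : ℝ) 1) {ω : Config d E}
    (h : Tendsto (fun n : ℕ => ⨆ σ : Config d E, |f (glue (cube d n) ω σ) - f ω|) atTop (𝓝 0)) :
    Tendsto (fun n => oscillation f n ω) atTop (𝓝 0) := by
  have h2 := h.const_mul 2
  rw [mul_zero] at h2
  refine squeeze_zero (fun n => oscillation_nonneg n ω) (fun n => ?_) h2
  have hb : BddAbove (Set.range fun σ : Config d E => |f (glue (cube d n) ω σ) - f ω|) :=
    ⟨1, by rintro _ ⟨τ, rfl⟩; exact abs_sub_le_one hf _ _⟩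
  refine Real.iSup_le (fun τ => ?_) (mul_nonneg zero_le_two (Real.iSup_nonneg fun _ => abs_nonneg _))
  have h1 := le_ciSup hb τ.1
  have h2 := le_ciSup hb τ.2
  have h3 := abs_sub_le (f (glue (cube d n) ω τ.1)) (f ω) (f (glue (cube d n) ω τ.2))
  rw [abs_sub_comm (f ω)] at h3
  linarith

theorem abs_log_sub_log_le {c x y : ℝ} (hc : 0 < c) (hx : c ≤ x) (hy : c ≤ y) :
    |Real.log x - Real.log y| ≤ c⁻¹ * |x - y| := by
  wlog hxy : y ≤ x generalizing x y
  · rw [abs_sub_comm, abs_sub_comm x]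
    exact this hy hx (le_of_not_ge hxy)
  have hx0 := hc.trans_le hx
  have hy0 := hc.trans_le hy
  rw [abs_of_nonneg (sub_nonneg.2 (Real.log_le_log hy0 hxy)), abs_of_nonneg (sub_nonneg.2 hxy),
    ← Real.log_div hx0.ne' hy0.ne']
  refine (Real.log_le_sub_one_of_pos (div_pos hx0 hy0)).trans ?_
  rw [div_sub_one hy0.ne', div_eq_inv_mul]
  exact mul_le_mul_of_nonneg_right (inv_anti₀ hc hy) (sub_nonneg.2 hxy)

theorem measurable_plusPast [MeasurableSpace E] (p : E) :
    Measurable (plusPast p : Config d E → Config d E) := by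
  refine measurable_pi_lambda _ fun i => ?_
  unfold plusPast
  split_ifs
  · exact measurable_pi_apply i
  · exact measurable_const

end Oscillation

/-! ### Logarithmic increments of a DLR measure -/

section LogRatio

variable {d : ℕ} {E : Type*}

theorem plusPast_zero (p : E) (σ : Config d E) : plusPast p σ 0 = σ 0 :=
  if_pos le_rfl

theorem const_eq_shift (x : Site d) (a : E) : const d a = shift x (const d a) := rfl

theorem map_singleton_neg (i : Site d) :
    ({i} : Finset (Site d)).map (addRightEmbedding (-i)) = {0} := by
  simp

namespace Specification

variable [MeasurableSpace E] {γ : Specification d E}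

/-- Only the spin at the origin matters in the first argument, which leaves finitely many kernels'
functions to control, one for each spin. -/
theorem logRatio_eq (p : E) (σ : Config d E) : γ.logRatio p σ =
    Real.log (γ.prob {0} (const d (σ 0)) (plusPast p σ) /
      γ.prob {0} (const d p) (plusPast p σ)) := by
  rw [logRatio, γ.prob_congr (σ := plusPast p σ) (τ := const d (σ 0))]
  intro i hi
  rw [Finset.mem_singleton.1 hi, plusPast_zero]
  rfl

theorem abs_log_prob_ratio_le {c : ℝ} (hc : 0 < c) (h : ∀ σ ω, c ≤ γ.prob {0} σ ω)
    (σ τ ω : Config d E) : |Real.log (γ.prob {0} σ ω / γ.prob {0} τ ω)| ≤ c⁻¹ := by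
  rw [Real.log_div (hc.trans_le (h _ _)).ne' (hc.trans_le (h _ _)).ne']
  refine (abs_log_sub_log_le hc (h _ _) (h _ _)).trans ?_
  refine mul_le_of_le_one_right (inv_nonneg.2 hc.le) ?_
  rw [abs_le]
  constructor <;>
    linarith [γ.prob_nonneg {0} σ ω, γ.prob_nonneg {0} τ ω, γ.prob_le_one {0} σ ω,
      γ.prob_le_one {0} τ ω]

/-- The sum over the spins `a` of the oscillations in `Λ_m` of the probability of `a` at the
origin. -/
noncomputable def originOscillation (γ : Specification d E) (m : ℕ) (ω : Config d E) : ℝ :=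
  ∑ᶠ a : E, oscillation (γ.prob {0} (const d a)) m ω

theorem prob_mem_Icc (Λ : Finset (Site d)) (σ ω : Config d E) : γ.prob Λ σ ω ∈ Set.Icc (0 : ℝ) 1 :=
  ⟨γ.prob_nonneg _ _ _, γ.prob_le_one _ _ _⟩

variable [Finite E]

theorem originOscillation_mem_Icc (m : ℕ) (ω : Config d E) :
    γ.originOscillation m ω ∈ Set.Icc (0 : ℝ) (Nat.card E) := by
  have := Fintype.ofFinite E
  rw [originOscillation, finsum_eq_sum_of_fintype]
  refine ⟨Finset.sum_nonneg fun _ _ => oscillation_nonneg _ _, ?_⟩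
  refine (Finset.sum_le_card_nsmul _ _ 1 fun a _ =>
    oscillation_le_one (fun ω => γ.prob_mem_Icc _ _ ω) _ _).trans ?_
  simp

theorem oscillation_le_originOscillation (a : E) (m : ℕ) (ω : Config d E) :
    oscillation (γ.prob {0} (const d a)) m ω ≤ γ.originOscillation m ω := by
  have := Fintype.ofFinite E
  rw [originOscillation, finsum_eq_sum_of_fintype]
  exact Finset.single_le_sum (f := fun a => oscillation (γ.prob {0} (const d a)) m ω)
    (fun _ _ => oscillation_nonneg _ _) (Finset.mem_univ a)

variable [MeasurableSingletonClass E]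

theorem measurable_logRatio (p : E) : Measurable (γ.logRatio p) := by
  have h : Measurable (Function.uncurry fun (a : E) (σ : Config d E) =>
      Real.log (γ.prob {0} (const d a) (plusPast p σ) /
        γ.prob {0} (const d p) (plusPast p σ))) :=
    measurable_from_prod_countable_right fun a =>
      (((γ.measurable_prob _ _).comp (measurable_plusPast p)).div
        ((γ.measurable_prob _ _).comp (measurable_plusPast p))).log
  have h' := h.comp ((measurable_pi_apply (X := fun _ : Site d => E) 0).prodMk measurable_id)
  rwa [show γ.logRatio p = _ from funext (logRatio_eq p)]

theorem IsUniformlyNonNull.integrable_logRatio [Nonempty E] (hnn : γ.IsUniformlyNonNull) (p : E)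
    (μ : Measure (Config d E)) [IsFiniteMeasure μ] : Integrable (γ.logRatio p) μ := by
  obtain ⟨c, hc, h⟩ := hnn.exists_le_prob {0}
  refine Integrable.of_bound (measurable_logRatio p).aestronglyMeasurable c⁻¹
    (Eventually.of_forall fun σ => ?_)
  exact abs_log_prob_ratio_le hc h _ _ _

theorem measurable_originOscillation (m : ℕ) : Measurable (γ.originOscillation m) := by
  have := Fintype.ofFinite E
  have h : γ.originOscillation m = fun ω => ∑ a, oscillation (γ.prob {0} (const d a)) m ω :=
    funext fun ω => finsum_eq_sum_of_fintype _
  rw [h]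
  exact Finset.measurable_sum _ fun a _ => measurable_of_dependsOn (dependsOn_oscillation _ _)

theorem tendsto_originOscillation {ω : Config d E} (h : ω ∈ γ.goodSet) :
    Tendsto (fun m => γ.originOscillation m ω) atTop (𝓝 0) := by
  have := Fintype.ofFinite E
  have h1 : Tendsto (fun m => ∑ a, oscillation (γ.prob {0} (const d a)) m ω) atTop
      (𝓝 (∑ a : E, 0)) := by
    refine tendsto_finsetSum _ fun a _ =>
      tendsto_oscillation (fun ω => γ.prob_mem_Icc _ _ ω) ?_
    -- Goodness is used for the indicators of single-spin events only.
    have hact : γ.act {0} ((cyl {0} (const d a)).indicator 1) = γ.prob {0} (const d a) :=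
      funext fun ω => integral_indicator_one (measurableSet_cyl _ _)
    rw [← hact]
    refine h {0} _ ⟨{0}, fun x y hxy => ?_⟩
    have hxy' := dependsOn_mem_cyl {0} (const d a) hxy
    classical
    rw [Set.indicator_apply, Set.indicator_apply]
    exact if_congr (iff_of_eq hxy') rfl rfl
  simpa only [originOscillation, finsum_eq_sum_of_fintype, Finset.sum_const_zero] using h1

theorem tendsto_integral_originOscillation {p : E} {μ : Measure (Config d E)}
    [IsProbabilityMeasure μ] (hgood : μ (γ.goodPastSet p) = 1) :
    Tendsto (fun m => ∫ σ, γ.originOscillation m (plusPast p σ) ∂μ) atTop (𝓝 0) := by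
  have hm : ∀ m, Measurable fun σ => γ.originOscillation m (plusPast p σ) := fun m =>
    (measurable_originOscillation m).comp (measurable_plusPast p)
  -- `goodPastSet` is not known to be measurable, so it is replaced by the larger, measurable set of
  -- convergence.
  have hA : MeasurableSet
      {σ | Tendsto (fun m => γ.originOscillation m (plusPast p σ)) atTop (𝓝 0)} :=
    measurableSet_tendsto _ hm
  have hae : ∀ᵐ σ ∂μ, Tendsto (fun m => γ.originOscillation m (plusPast p σ)) atTop (𝓝 0) := by
    refine (mem_ae_iff_prob_eq_one hA).2 (le_antisymm MeasureTheory.prob_le_one ?_)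
    rw [← hgood]
    exact measure_mono fun σ hσ => tendsto_originOscillation hσ
  have := tendsto_integral_of_dominated_convergence (μ := μ) (fun _ => (Nat.card E : ℝ))
    (fun m => (hm m).aestronglyMeasurable) (integrable_const _)
    (fun m => Eventually.of_forall fun σ => by
      have h := originOscillation_mem_Icc (γ := γ) m (plusPast p σ)
      rw [Real.norm_of_nonneg h.1]
      exact h.2) hae
  simpa using this

/-- After translation by `-i`, `ω` agrees on `Λ_m` with the configuration defining `logRatio`,
except perhaps at the origin. Numerator and denominator each cost one oscillation times the
Lipschitz constant `c⁻¹` of the logarithm on `[c, ∞)`. -/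
theorem abs_log_prob_ratio_sub_logRatio_le {c : ℝ} (hc : 0 < c)
    (h : ∀ σ ω, c ≤ γ.prob {0} σ ω) (hγ : γ.IsTranslationInvariant) (p : E) {Λ : Finset (Site d)}
    {m : ℕ} {i : Site d} (hΛ : ∀ j ∈ cube d m, j + i ∈ Λ) {σ ω : Config d E}
    (hω : ω ∈ cyl (Λ.erase i) (glue (fromSite Λ i) σ (const d p))) :
    |Real.log (γ.prob {i} (const d (σ i)) ω / γ.prob {i} (const d p) ω) -
      γ.logRatio p (shift (-i) σ)| ≤
      2 * c⁻¹ * γ.originOscillation m (plusPast p (shift (-i) σ)) := by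
  set ζ := plusPast p (shift (-i) σ) with hζ
  -- The spin of `ω` at `i` is free but invisible to `γ_{i}`, so it may be reset to `σ i`.
  set η := Function.update (shift (-i) ω) 0 (σ i) with hη
  have hq : ∀ a, γ.prob {i} (const d a) ω = γ.prob {0} (const d a) η := by
    intro a
    rw [← hγ.prob_shift (-i), map_singleton_neg, ← const_eq_shift]
    refine γ.dependsOn_prob _ _ fun j hj => ?_
    rw [hη, Function.update_of_ne (by simpa using hj)]
  have hagree : ∀ j ∈ cube d m, η j = ζ j := by
    intro j hj
    by_cases hj0 : j = 0
    · rw [hj0, hζ, plusPast_zero, hη, Function.update_self]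
      simp [shift]
    · have hjΛ := hΛ j hj
      have h1 := hω (j + i) (Finset.mem_erase.2 ⟨by simpa using hj0, hjΛ⟩)
      have h2 : toLex (0 : Site d) ≤ toLex j ↔ toLex i ≤ toLex (j + i) := by
        rw [← zero_le_toLex_sub (i := i), add_sub_cancel_right]
      rw [hη, Function.update_of_ne hj0]
      simp only [shift, sub_neg_eq_add, hζ, plusPast, h1, glue, mem_fromSite, hjΛ, true_and, h2,
        const]
  have h0 : shift (-i) σ 0 = σ i := by simp [shift]
  have hosc : ∀ a, |Real.log (γ.prob {0} (const d a) η) - Real.log (γ.prob {0} (const d a) ζ)| ≤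
      c⁻¹ * γ.originOscillation m ζ := fun a =>
    (abs_log_sub_log_le hc (h _ _) (h _ _)).trans (mul_le_mul_of_nonneg_left
      ((abs_sub_le_oscillation (fun ω => γ.prob_mem_Icc _ _ ω) hagree).trans
        (oscillation_le_originOscillation a m ζ)) (inv_nonneg.2 hc.le))
  have hne : ∀ σ ω, γ.prob {0} σ ω ≠ 0 := fun σ ω => (hc.trans_le (h σ ω)).ne'
  rw [hq, hq, logRatio_eq, h0, ← hζ, Real.log_div (hne _ _) (hne _ _),
    Real.log_div (hne _ _) (hne _ _)]
  have h1 := abs_le.1 (hosc (σ i))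
  have h2 := abs_le.1 (hosc p)
  rw [abs_le]
  constructor <;> linarith [h1.1, h1.2, h2.1, h2.2]

/-- The logarithmic increment of `ν` at `i`, when the spins of `Λ` are turned successively into
the reference spin `p`, is close to a translate of `logRatio`. -/
theorem abs_log_increment_sub_logRatio_le [Nonempty E] (hnn : γ.IsUniformlyNonNull)
    {ν : Measure (Config d E)} (hν : γ.IsDLR ν) (p : E) {Λ : Finset (Site d)} {i : Site d}
    (hi : i ∈ Λ) (σ : Config d E) {K : ℝ}
    (hK : ∀ ω ∈ cyl (Λ.erase i) (glue (fromSite Λ i) σ (const d p)),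
      |Real.log (γ.prob {i} (const d (σ i)) ω / γ.prob {i} (const d p) ω) -
        γ.logRatio p (shift (-i) σ)| ≤ K) :
    |Real.log (ν.real (cyl Λ (glue (fromSite Λ i) σ (const d p)))) -
      Real.log (ν.real (cyl Λ (glue (afterSite Λ i) σ (const d p)))) -
        γ.logRatio p (shift (-i) σ)| ≤ K := by
  refine hnn.abs_log_ratio_sub_le hν hi (fun j _ hji => ?_) fun ω hω => ?_
  · rw [glue, glue, fromSite_eq_insert hi]
    simp [hji]
  · have h1 : γ.prob {i} (glue (fromSite Λ i) σ (const d p)) ω = γ.prob {i} (const d (σ i)) ω := by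
      refine γ.prob_congr (fun j hj => ?_) ω
      rw [Finset.mem_singleton.1 hj, glue, if_pos (mem_fromSite.2 ⟨hi, le_rfl⟩)]
      rfl
    have h2 : γ.prob {i} (glue (afterSite Λ i) σ (const d p)) ω = γ.prob {i} (const d p) ω := by
      refine γ.prob_congr (fun j hj => ?_) ω
      rw [Finset.mem_singleton.1 hj, glue,
        if_neg fun h => lt_irrefl _ (mem_afterSite.1 h).2]
    rw [h1, h2]
    exact hK ω hω

/-- The limit is the same for all DLR measures `ν`; this is what allows `ν = μ` later.
Translation-invariance of `μ` gives all translates of `logRatio` the same integral. -/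
theorem tendsto_integral_log_cyl [Nonempty E] (hγ : γ.IsTranslationInvariant) (hnn : γ.IsUniformlyNonNull)
    {ν : Measure (Config d E)} (hν : γ.IsDLR ν) {μ : Measure (Config d E)}
    [IsProbabilityMeasure μ] (hμ : DLR.IsTranslationInvariant μ) {p : E}
    (hgood : μ (γ.goodPastSet p) = 1) :
    Tendsto (fun n : ℕ => (∫ σ, Real.log (ν.real (cyl (cube d n) σ)) ∂μ -
      Real.log (ν.real (cyl (cube d n) (const d p)))) / (cube d n).card) atTop
      (𝓝 (∫ σ, γ.logRatio p σ ∂μ)) := by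
  obtain ⟨c, hc, h⟩ := hnn.exists_le_prob {0}
  -- The cube stays fixed while `A` shrinks, so `V` passes from `σ` at `A = Λ_n` to the constant
  -- configuration at `A = ∅`.
  let V : ℕ → Finset (Site d) → Config d E → ℝ := fun n A σ =>
    Real.log (ν.real (cyl (cube d n) (glue A σ (const d p))))
  have hV : ∀ n A, Integrable (V n A) μ := fun n A =>
    integrable_of_dependsOn (Λ := A) fun x y hxy => by
      have : glue A x (const d p) = glue A y (const d p) := by
        funext j
        by_cases hj : j ∈ A
        · simp [glue, hj, hxy j hj]
        · simp [glue, hj]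
      simp only [V, this]
  have hVsub : ∀ n A B, Integrable (fun σ => V n A σ - V n B σ) μ := fun n A B =>
    (hV n A).sub (hV n B)
  have hR := hnn.integrable_logRatio p μ
  have hRi : ∀ i, Integrable (fun σ => γ.logRatio p (shift (-i) σ)) μ := fun i => by
    refine Integrable.comp_measurable (g := γ.logRatio p) ?_ (measurable_shift (-i))
    rwa [hμ (-i)]
  have hRint : ∀ i, ∫ σ, γ.logRatio p (shift (-i) σ) ∂μ = ∫ σ, γ.logRatio p σ ∂μ := fun i => by
    conv_rhs => rw [← hμ (-i)]
    exact (integral_map (measurable_shift _).aemeasurable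
      (measurable_logRatio p).aestronglyMeasurable).symm
  have hO : ∀ m i, ∫ σ, γ.originOscillation m (plusPast p (shift (-i) σ)) ∂μ =
      ∫ σ, γ.originOscillation m (plusPast p σ) ∂μ := fun m i => by
    conv_rhs => rw [← hμ (-i)]
    exact (integral_map (measurable_shift _).aemeasurable ((measurable_originOscillation m).comp
      (measurable_plusPast p)).aestronglyMeasurable).symm
  have hOint : ∀ m i, Integrable
      (fun σ => γ.originOscillation m (plusPast p (shift (-i) σ))) μ := fun m i =>
    Integrable.of_bound (((measurable_originOscillation m).comp (measurable_plusPast p)).comp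
      (measurable_shift (-i))).aestronglyMeasurable (Nat.card E)
      (Eventually.of_forall fun σ => by
        have h := originOscillation_mem_Icc (γ := γ) m (plusPast p (shift (-i) σ))
        rw [Real.norm_of_nonneg h.1]
        exact h.2)
  have hdiff : ∀ n i, ∫ σ, (V n (fromSite (cube d n) i) σ - V n (afterSite (cube d n) i) σ) ∂μ -
      ∫ σ, γ.logRatio p σ ∂μ = ∫ σ, (V n (fromSite (cube d n) i) σ -
        V n (afterSite (cube d n) i) σ - γ.logRatio p (shift (-i) σ)) ∂μ := fun n i => by
    rw [integral_sub (hVsub _ _ _) (hRi i), hRint]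
  have hε := ((tendsto_integral_originOscillation hgood).const_mul (2 * c⁻¹))
  rw [mul_zero] at hε
  have hav := tendsto_average_cube (c := fun n i =>
    ∫ σ, (V n (fromSite (cube d n) i) σ - V n (afterSite (cube d n) i) σ) ∂μ)
    (L := ∫ σ, γ.logRatio p σ ∂μ) (C := 2 * c⁻¹) hε ?_ ?_
  · refine hav.congr fun n => ?_
    congr 1
    rw [← integral_finsetSum _ fun i _ => hVsub _ _ _]
    have hsum : ∀ σ, ∑ i ∈ cube d n, (V n (fromSite (cube d n) i) σ -
        V n (afterSite (cube d n) i) σ) = Real.log (ν.real (cyl (cube d n) σ)) -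
          Real.log (ν.real (cyl (cube d n) (const d p))) := by
      intro σ
      rw [sum_increments fun A => V n A σ]
      congr 1
      · refine congrArg (fun A => Real.log (ν.real A)) (cyl_congr fun j hj => ?_)
        simp [glue, hj]
    simp only [hsum]
    rw [integral_sub (integrable_comp_cyl μ _ fun A => Real.log (ν.real A)) (integrable_const _)]
    simp
  · intro n i hi
    rw [hdiff]
    have hb := norm_integral_le_of_norm_le_const (μ := μ) (C := 2 * c⁻¹)
      (f := fun σ => V n (fromSite (cube d n) i) σ - V n (afterSite (cube d n) i) σ -
        γ.logRatio p (shift (-i) σ)) (Eventually.of_forall fun σ => ?_)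
    · simpa using hb
    -- A crude bound valid up to the boundary: both log-ratios are at most `c⁻¹` in absolute value.
    refine abs_log_increment_sub_logRatio_le hnn hν p hi σ fun ω _ => ?_
    refine (abs_sub _ _).trans ?_
    rw [two_mul]
    refine add_le_add ?_ (abs_log_prob_ratio_le hc h _ _ _)
    rw [← hγ.prob_shift (-i), ← hγ.prob_shift (-i) _ (const d p), map_singleton_neg]
    exact abs_log_prob_ratio_le hc h _ _ _
  · intro m n hmn i hi
    have hΛ : ∀ j ∈ cube d m, j + i ∈ cube d n := fun j hj => by
      simpa [hmn] using add_mem_cube hj hi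
    rw [hdiff, ← hO m i, ← integral_const_mul]
    refine norm_integral_le_of_norm_le (f := fun σ => V n (fromSite (cube d n) i) σ -
      V n (afterSite (cube d n) i) σ - γ.logRatio p (shift (-i) σ))
      ((hOint m i).const_mul _) (Eventually.of_forall fun σ => ?_)
    exact abs_log_increment_sub_logRatio_le hnn hν p (cube_mono (Nat.sub_le _ _) hi) σ
      fun ω hω => abs_log_prob_ratio_sub_logRatio_le hc h hγ p hΛ hω

end Specification

end LogRatio

/-! ### Relative entropy in finite volume -/

section RelativeEntropy

theorem absolutelyContinuous_of_singleton_pos {α : Type*} [MeasurableSpace α] (μ : Measure α)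
    {ν : Measure α} (hν : ∀ x, 0 < ν.real {x}) : μ ≪ ν := by
  have hν0 : ∀ x, ν {x} ≠ 0 := fun x h => (hν x).ne' (by simp [measureReal_def, h])
  intro s hs
  have : s = ∅ := Set.eq_empty_of_forall_notMem fun x hx =>
    hν0 x (measure_mono_null (Set.singleton_subset_iff.2 hx) hs)
  rw [this, measure_empty]

theorem klDiv_toReal_eq_sum_of_pos {α : Type*} [Fintype α] [MeasurableSpace α]
    [MeasurableSingletonClass α] (μ ν : Measure α) [IsProbabilityMeasure μ]
    [IsProbabilityMeasure ν] (hν : ∀ x, 0 < ν.real {x}) :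
    (InformationTheory.klDiv μ ν).toReal =
      ∑ x, μ.real {x} * Real.log (μ.real {x} / ν.real {x}) := by
  have hac := absolutelyContinuous_of_singleton_pos μ hν
  have hd : ∀ x, (μ.rnDeriv ν x).toReal = μ.real {x} / ν.real {x} := by
    intro x
    have h1 := Measure.setLIntegral_rnDeriv hac {x}
    rw [lintegral_singleton] at h1
    rw [eq_div_iff (hν x).ne', measureReal_def, measureReal_def, ← ENNReal.toReal_mul, h1]
  -- The total masses agree, so no mass correction appears.
  rw [InformationTheory.toReal_klDiv_of_measure_eq hac (by simp), integral_fintype .of_finite]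
  simp [llr, hd]

variable {d : ℕ} {E : Type*} [Fintype E] [MeasurableSpace E] [MeasurableSingletonClass E]

/-- Positivity of all `ν`-cylinders gives absolute continuity, hence finiteness on a finite space.
-/
theorem relEntropy_eq (μ ν : Measure (Config d E)) [IsProbabilityMeasure μ]
    [IsProbabilityMeasure ν] (Λ : Finset (Site d)) (hν : ∀ σ, 0 < ν.real (cyl Λ σ)) :
    relEntropy Λ μ ν ≠ ∞ ∧ (relEntropy Λ μ ν).toReal =
      -blockEntropy μ Λ - ∫ σ, Real.log (ν.real (cyl Λ σ)) ∂μ := by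
  have hr : Measurable (Λ.restrict (π := fun _ => E)) := Finset.measurable_restrict Λ
  have := Measure.isProbabilityMeasure_map (μ := μ) hr.aemeasurable
  have := Measure.isProbabilityMeasure_map (μ := ν) hr.aemeasurable
  have hsurj : ∀ η : Λ → E, ∃ σ : Config d E, Λ.restrict σ = η := by
    intro η
    rcases isEmpty_or_nonempty E with hE | hE
    · obtain ⟨σ⟩ := nonempty_of_isProbabilityMeasure μ
      exact ⟨σ, funext fun i => hE.elim (η i)⟩
    · classical
      refine ⟨fun i => if h : i ∈ Λ then η ⟨i, h⟩ else Classical.arbitrary E, ?_⟩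
      funext i
      simp
  have hmap : ∀ (ρ : Measure (Config d E)) (η : Λ → E),
      (ρ.map Λ.restrict).real {η} = ρ.real (Λ.restrict ⁻¹' {η}) := fun ρ η =>
    map_measureReal_apply hr (measurableSet_singleton η)
  have hpos : ∀ η : Λ → E, 0 < (ν.map Λ.restrict).real {η} := by
    intro η
    obtain ⟨σ, rfl⟩ := hsurj η
    rw [hmap, restrict_preimage_singleton]
    exact hν σ
  refine ⟨InformationTheory.klDiv_ne_top (absolutelyContinuous_of_singleton_pos _ hpos)
    .of_finite, ?_⟩
  rw [relEntropy, klDiv_toReal_eq_sum_of_pos _ _ hpos]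
  have hlog := fun (ρ : Measure (Config d E)) =>
    integrable_comp_cyl μ Λ fun A => Real.log (ρ.real A)
  have h := integral_comp_eq_sum μ hr fun η => Real.log
    (μ.real (Λ.restrict (π := fun _ => E) ⁻¹' {η}) / ν.real (Λ.restrict ⁻¹' {η}))
  simp only [restrict_preimage_singleton] at h
  simp only [hmap, ← h]
  rw [blockEntropy, integral_neg, neg_neg, ← integral_sub (hlog μ) (hlog ν)]
  refine integral_congr_ae ?_
  filter_upwards [ae_measureReal_cyl_pos μ Λ] with σ hσ
  exact Real.log_div hσ.ne' (hν σ).ne'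

theorem hasRelEntropyDensity_of_tendsto {μ ν : Measure (Config d E)} [IsProbabilityMeasure μ]
    [IsProbabilityMeasure ν] (hν : ∀ Λ σ, 0 < ν.real (cyl Λ σ)) {h : ℝ}
    (hlim : Tendsto (fun n : ℕ => (-blockEntropy μ (cube d n) -
      ∫ σ, Real.log (ν.real (cyl (cube d n) σ)) ∂μ) / (cube d n).card) atTop (𝓝 h)) :
    HasRelEntropyDensity μ ν h := by
  refine (continuous_coe_real_ereal.tendsto h |>.comp hlim).congr fun n => ?_
  obtain ⟨htop, heq⟩ := relEntropy_eq μ ν (cube d n) (hν _)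
  have hpos := card_cube_pos (d := d) n
  rw [Function.comp_apply, ← heq, ← ENNReal.toReal_natCast, ← ENNReal.toReal_div,
    EReal.coe_ennreal_toReal]
  exact ENNReal.div_ne_top htop (by exact_mod_cast hpos.ne')

end RelativeEntropy

end DLR

theorem mainTheorem4 {d : ℕ} {E : Type*} [Fintype E] [Nonempty E] [MeasurableSpace E]
    [MeasurableSingletonClass E] (p : E)
    (γ : DLR.Specification d E) (hγ : γ.IsTranslationInvariant) (hnn : γ.IsUniformlyNonNull)
    (ν : Measure (DLR.Config d E)) (hν : γ.IsInvariantDLR ν)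
    (μ : Measure (DLR.Config d E)) [IsProbabilityMeasure μ] (hμ : DLR.IsTranslationInvariant μ)
    (hgood : μ (γ.goodPastSet p) = 1)
    (e : ℝ) (he : DLR.HasSpecificEnergy ν p e) :
    Integrable (γ.logRatio p) μ ∧
    ∃ h : ℝ, DLR.HasEntropy μ h ∧
      DLR.HasRelEntropyDensity μ ν (-h + e - ∫ σ, γ.logRatio p σ ∂μ) ∧
      (γ.IsInvariantDLR μ →
        Tendsto (fun n : ℕ =>
            Real.log (μ.real (DLR.cyl (DLR.cube d n) (DLR.const d p)) /
              ν.real (DLR.cyl (DLR.cube d n) (DLR.const d p))) / ((DLR.cube d n).card : ℝ))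
          atTop (𝓝 (-h + e - ∫ σ, γ.logRatio p σ ∂μ))) := by
  have := hν.1.1
  obtain ⟨h, hh⟩ := DLR.exists_hasEntropy hμ
  have hh' : Tendsto (fun n => DLR.blockEntropy μ (DLR.cube d n) / (DLR.cube d n).card) atTop
      (𝓝 h) := hh.congr fun n => DLR.entropyPerSite_eq μ n
  have hposν := hnn.measureReal_cyl_pos hν.1
  refine ⟨hnn.integrable_logRatio p μ, h, hh, ?_, fun hμγ => ?_⟩
  · refine DLR.hasRelEntropyDensity_of_tendsto hposν ?_
    -- The terms `log ν(+_{Λ_n})` cancel.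
    refine ((hh'.neg.add he).sub
      (DLR.Specification.tendsto_integral_log_cyl hγ hnn hν.1 hμ hgood)).congr fun n => ?_
    ring
  · have hposμ := hnn.measureReal_cyl_pos hμγ.1
    -- With `μ` as the DLR measure, `∫ log μ(σ_{Λ_n}) dμ` cancels the entropy.
    refine ((hh'.neg.add he).sub
      (DLR.Specification.tendsto_integral_log_cyl hγ hnn hμγ.1 hμ hgood)).congr fun n => ?_
    rw [Real.log_div (hposμ _ _).ne' (hposν _ _).ne', DLR.blockEntropy, integral_neg]
    ring
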